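/- Let $Q$, $A$, $E$ be non-empty finite sets (states, actions, environments). A multi-environment Markov decision process (MEMDP) is $\Gamma=(Q,A,E,(\delta_e)_{e\in E})$ with $\delta_e\colon Q\times A\to\mathcal D(Q)$ for every $e\in E$, where $\mathcal D(X)$ denotes the set of probability distributions on $X$. A pair $(q,a)\in Q\times A$ is *distinguishing* if $\delta_e(q,a)\neq\delta_{e'}(q,a)$ for some $e\ne e'$ in $E$. A strategy is a function $\sigma\colon Q\cdot(A\cdot Q)^*\to\mathcal D(A)$; for $q\in Q$ and $e\in E$, $\mathbb P^{\sigma}_q[\Gamma[e],\cdot]$ is the probability measure on the infinite runs from $q$ that $\sigma$ induces in the Markov decision process $\Gamma[e]=(Q,A,\delta_e)$. For a prior belief $b\in\mathcal D(E)$, the belief $\mathsf{lk}_b(\rho)\in\mathcal D(E)$ after a finite run $\rho$ is given by $\mathsf{lk}_b(q)=b$ and $$\mathsf{lk}_b(\rho\cdot(a,q'))(e)=\frac{\mathsf{lk}_b(\rho)(e)\,\delta_e(h,a)(q')}{\sum_{f\in E}\mathsf{lk}_b(\rho)(f)\,\delta_f(h,a)(q')},$$ where $h$ is the last state of $\rho$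 (if the denominator is $0$, an arbitrary distribution is allowed; we take $\mathsf{lk}_b(\rho)$). For $\varepsilon>0$ let $\mathsf{NeverSmallBelief}(b,\varepsilon)$ be the set of finite runs $\rho$ such that $\mathsf{lk}_b(\pi)(e)>\varepsilon$ for every prefix $\pi$ of $\rho$ and every $e\in E$. Let $k=|E|$, let $l$ be the maximum number of bits needed to write a probability $\delta_e(q,a)(q')$ as a fraction in lowest terms (numerator and denominator in binary; $l=\infty$ if one of them is irrational), and let $x=\max(0,\lceil\log_2(1/\varepsilon)\rceil)$. **Theorem.** There is a polynomial $P\in\mathbb N[X_1,X_2,X_3]$ such that for every MEMDP $\Gamma$ and every $\varepsilon>0$ there is $m=m(\Gamma,\varepsilon)\in\mathbb N$, with $m\le P(k,2^l,x)$ whenever $l<\infty$, such that for every prior belief $b\in\mathcal D(E)$, every $q\in Q$, every strategy $\sigma$ and every environment $e\in E$, each of the following two events has probability at most $\varepsilon$ under $\mathbb P^{\sigma}_q[\Gamma[e],\cdot]$: 1. the infinite run visits distinguishing state-action pairs at least $m$ times, and all its finite prefixes lie in $\mathsf{NeverSmallBelief}(b,\varepsilon)$; 2. the infinite run has a finite prefix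 $\rho\in\mathsf{NeverSmallBelief}(b,\varepsilon)$ in which at least $m$ of the transitions are taken from distinguishing state-action pairs. -/

import Mathlib

open MeasureTheory ProbabilityTheory
open scoped ENNReal NNReal

/-- A finite run `q₀ (a₁, q₁) ⋯ (aₙ, qₙ)`, i.e. an element of `Q · (A · Q)^*`. -/
inductive FinRun (Q A : Type*) where
  | start (q : Q) : FinRun Q A
  | step (ρ : FinRun Q A) (a : A) (q : Q) : FinRun Q A

namespace FinRun

variable {Q A : Type*}

/-- The last state of a finite run. -/
def head : FinRun Q A → Q
  | start q => q
  | step _ _ q => q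

/-- `IsPrefix π ρ` says that `π` is a prefix of `ρ` (possibly `ρ` itself). -/
def IsPrefix (π : FinRun Q A) : FinRun Q A → Prop
  | start q => π = start q
  | step ρ a q => π = step ρ a q ∨ IsPrefix π ρ

/-- The prefix with `n` transitions of the infinite run `q · ω 0 · ω 1 ⋯`, where each `ω i` is a
pair (action played, state reached). The infinite runs from `q` are exactly the runs
`q · ω` with `ω : ℕ → A × Q`, i.e. `q · (A · Q)^ω ⊆ (Q · A)^ω`. -/
def ofSeq (q : Q) (ω : ℕ → A × Q) : ℕ → FinRun Q A
  | 0 => start q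
  | n + 1 => step (ofSeq q ω n) (ω n).1 (ω n).2

end FinRun

/-- A (randomized, history-dependent) strategy on `(Q, A)`. -/
abbrev Strategy (Q A : Type*) := FinRun Q A → PMF A

/-- A Markov decision process with states `Q` and actions `A`. -/
structure MDP (Q A : Type*) where
  /-- the transition function -/
  δ : Q → A → PMF Q

namespace MDP

variable {Q A : Type*}

/-- The law of the next pair (action, state) after the finite run `ρ`:
`(a, t)` has probability `σ(ρ)(a) · δ(head ρ, a)(t)`. -/
noncomputable def stepDist (G : MDP Q A) (σ : Strategy Q A) (ρ : FinRun Q A) : PMF (A × Q) :=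
  (σ ρ).bind fun a => (G.δ ρ.head a).map fun t => (a, t)

/-- The transition kernel of the process of pairs (action, state) of the runs from `q`: given the
first `n + 1` pairs `x 0, …, x n`, it is the law of the next pair after the run
`q · x 0 ⋯ x n`. -/
noncomputable def stepKernel [Finite Q] [Finite A]
    [MeasurableSpace Q] [DiscreteMeasurableSpace Q]
    [MeasurableSpace A] [DiscreteMeasurableSpace A]
    (G : MDP Q A) (σ : Strategy Q A) (q : Q) (n : ℕ) :
    Kernel (Π _ : Finset.Iic n, A × Q) (A × Q) :=
  Kernel.ofFunOfCountable fun x =>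
    (G.stepDist σ (FinRun.ofSeq q
      (fun i => x ⟨min i n, Finset.mem_Iic.2 (min_le_right i n)⟩) (n + 1))).toMeasure

instance [Finite Q] [Finite A]
    [MeasurableSpace Q] [DiscreteMeasurableSpace Q]
    [MeasurableSpace A] [DiscreteMeasurableSpace A]
    (G : MDP Q A) (σ : Strategy Q A) (q : Q) (n : ℕ) :
    IsMarkovKernel (G.stepKernel σ q n) :=
  ⟨fun _ => PMF.toMeasure.isProbabilityMeasure _⟩

/-- The probability measure on the infinite runs from `q` that the strategy `σ` induces in `G`
(Ionescu-Tulcea extension). A set of infinite runs from `q` is given by the set of the sequences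
`ω` of the pairs (action, state) that follow `q`. -/
noncomputable def runMeasure [Finite Q] [Finite A]
    [MeasurableSpace Q] [DiscreteMeasurableSpace Q]
    [MeasurableSpace A] [DiscreteMeasurableSpace A]
    (G : MDP Q A) (σ : Strategy Q A) (q : Q) : Measure (ℕ → A × Q) :=
  Kernel.trajMeasure (X := fun _ => A × Q)
    (G.stepDist σ (FinRun.start q)).toMeasure (G.stepKernel σ q)

end MDP

/-- A multi-environment Markov decision process with states `Q`, actions `A` and
environments `E`. -/
structure MEMDP (Q A E : Type*) where
  /-- the transition function of each environment -/
  δ : E → Q → A → PMF Q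

/-- The number of bits used to write a probability as a fraction in lowest terms (numerator and
denominator in binary); `⊤` if the probability is irrational. -/
noncomputable def bitLength (p : ℝ≥0∞) : ℕ∞ :=
  ⨅ (r : ℚ≥0) (_ : ((r : ℝ≥0) : ℝ≥0∞) = p), ((Nat.size r.num + Nat.size r.den : ℕ) : ℕ∞)

namespace MEMDP

variable {Q A E : Type*}

/-- The MDP obtained by fixing the environment `e`. -/
def env (Γ : MEMDP Q A E) (e : E) : MDP Q A := ⟨Γ.δ e⟩

/-- The maximum number of bits needed to write a probability that occurs in `Γ`. -/
noncomputable def maxBits (Γ : MEMDP Q A E) : ℕ∞ :=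
  ⨆ (e : E) (q : Q) (a : A) (t : Q), bitLength (Γ.δ e q a t)

/-- The `(e, e')`-distinguishing state-action pairs. -/
def dstgPair (Γ : MEMDP Q A E) (e e' : E) : Set (Q × A) :=
  {x | Γ.δ e x.1 x.2 ≠ Γ.δ e' x.1 x.2}

/-- The distinguishing state-action pairs. -/
def dstg (Γ : MEMDP Q A E) : Set (Q × A) :=
  {x | ∃ e e' : E, e ≠ e' ∧ x ∈ Γ.dstgPair e e'}

/-- The law `p[b, q, a]` of the successor state under the belief `b`:
`p[b, q, a](t) = ∑ e, b(e) · δ_e(q, a)(t)`. -/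
noncomputable def succDist (Γ : MEMDP Q A E) (b : PMF E) (q : Q) (a : A) : PMF Q :=
  b.bind fun e => Γ.δ e q a

open Classical in
/-- The updated belief `λ[b, q, a, t](e) = b(e) · δ_e(q, a)(t) / p[b, q, a](t)`. If
`p[b, q, a](t) = 0`, where an arbitrary distribution is allowed, the belief is left unchanged. -/
noncomputable def beliefUpdate (Γ : MEMDP Q A E) (b : PMF E) (q : Q) (a : A) (t : Q) : PMF E :=
  if h : Γ.succDist b q a t = 0 then b
  else ⟨fun e => b e * Γ.δ e q a t / Γ.succDist b q a t, by
    have h0 : ∑' e, b e * Γ.δ e q a t = Γ.succDist b q a t := (PMF.bind_apply _ _ _).symm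
    have h1 : ∑' e, b e * Γ.δ e q a t / Γ.succDist b q a t = 1 := by
      simp only [div_eq_mul_inv]
      rw [ENNReal.tsum_mul_right, h0]
      exact ENNReal.mul_inv_cancel h (PMF.apply_ne_top _ _)
    exact h1 ▸ ENNReal.summable.hasSum⟩

/-- The environment belief after a finite run, from the prior belief `b`. -/
noncomputable def lk (Γ : MEMDP Q A E) (b : PMF E) : FinRun Q A → PMF E
  | .start _ => b
  | .step ρ a t => Γ.beliefUpdate (Γ.lk b ρ) ρ.head a t

/-- The finite runs along which the belief in every environment always stays above `ε`. -/
def neverSmallBelief (Γ : MEMDP Q A E) (b : PMF E) (ε : ℝ) : Set (FinRun Q A) :=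
  {ρ | ∀ π : FinRun Q A, π.IsPrefix ρ → ∀ e : E, ENNReal.ofReal ε < Γ.lk b π e}

open Classical in
/-- The number of transitions of a finite run that leave from a distinguishing state-action
pair. -/
noncomputable def nbDstgFin (Γ : MEMDP Q A E) : FinRun Q A → ℕ
  | .start _ => 0
  | .step ρ a _ => Γ.nbDstgFin ρ + if (ρ.head, a) ∈ Γ.dstg then 1 else 0

/-- The number of times that the infinite run `q · ω` visits a distinguishing state-action pair. -/
noncomputable def nbDstg (Γ : MEMDP Q A E) (q : Q) (ω : ℕ → A × Q) : ℕ∞ :=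
  Set.encard {i : ℕ | ((FinRun.ofSeq q ω i).head, (ω i).1) ∈ Γ.dstg}

end MEMDP

/-! Fix the true environment `e` and a rival `f`. Under `e`, the square root of the likelihood ratio
of `f` to `e` is a nonnegative supermartingale, and at a pair that distinguishes `e` from `f` its
mean shrinks by the Bhattacharyya coefficient, at most `1 - η² / 8` when the two laws differ by `η`
at some state. It therefore stays a supermartingale when multiplied by `γ = (1 - η² / 8)⁻¹` at each
such visit (`tsum_stepDist_mul_sqrtLikelihood_le`).

By Bayes' rule the likelihood ratio is the ratio of posterior odds to prior odds, so it exceeds `ε²`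
while all beliefs exceed `ε`; after `N` visits the amplified root is at least `ε γ ^ N`
(`mul_pow_le_sqrtLikelihood`). Ville's inequality bounds the probability of this by `1 / (ε γ ^ N)`,
which is at most `ε / k` for the chosen `N` (`inv_mul_pow_le`). Among `k N` distinguishing visits,
some `f` accounts for `N`, and a union bound over `f` concludes. -/

/-! ### Run measure: one-step expectations. -/

namespace FinRun

variable {Q A : Type*}

theorem ofSeq_congr (q : Q) {ω ω' : ℕ → A × Q} {n : ℕ} (h : ∀ i < n, ω i = ω' i) :
    ofSeq q ω n = ofSeq q ω' n := by
  induction n with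
  | zero => rfl
  | succ n ih =>
    simp only [ofSeq, ih fun i hi => h i (hi.trans n.lt_succ_self), h n n.lt_succ_self]

theorem ofSeq_succ_eq_frestrictLe (q : Q) (ω : ℕ → A × Q) (n : ℕ) :
    ofSeq q ω (n + 1) = ofSeq q (fun i =>
      Preorder.frestrictLe (π := fun _ => A × Q) n ω
        ⟨min i n, Finset.mem_Iic.2 (min_le_right i n)⟩) (n + 1) := by
  refine ofSeq_congr q fun i hi => ?_
  simp [Preorder.frestrictLe, min_eq_left (Nat.lt_succ_iff.1 hi)]

end FinRun

namespace MDP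

variable {Q A : Type*} [Finite Q] [Finite A]
  [MeasurableSpace Q] [DiscreteMeasurableSpace Q]
  [MeasurableSpace A] [DiscreteMeasurableSpace A]

instance (G : MDP Q A) (σ : Strategy Q A) (q : Q) : IsProbabilityMeasure (G.runMeasure σ q) := by
  unfold runMeasure
  infer_instance

/-- `FinRun Q A` carries no σ-algebra; the map factors through the first pairs, a finite discrete
space. -/
theorem measurable_comp_ofSeq {β : Type*} [MeasurableSpace β] (F : FinRun Q A → β) (q : Q) (n : ℕ) :
    Measurable fun ω : ℕ → A × Q => F (FinRun.ofSeq q ω n) := by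
  cases n with
  | zero => exact measurable_const (a := F (.start q))
  | succ n =>
    have h : (fun ω : ℕ → A × Q => F (FinRun.ofSeq q ω (n + 1))) = _ :=
      funext fun ω => congrArg F (FinRun.ofSeq_succ_eq_frestrictLe q ω n)
    rw [h]
    exact (Measurable.of_discrete (f := fun x : Π _ : Finset.Iic n, A × Q =>
      F (FinRun.ofSeq q (fun i => x ⟨min i n, Finset.mem_Iic.2 (min_le_right i n)⟩) (n + 1)))).comp
        (Preorder.measurable_frestrictLe n)

theorem runMeasure_map_zero (G : MDP Q A) (σ : Strategy Q A) (q : Q) :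
    (G.runMeasure σ q).map (fun ω => ω 0) = (G.stepDist σ (FinRun.start q)).toMeasure := by
  have h : (fun ω : ℕ → A × Q => ω 0) =
      (MeasurableEquiv.piUnique (fun _ : Finset.Iic 0 => A × Q)) ∘ Preorder.frestrictLe 0 := rfl
  rw [h, ← Measure.map_map (by fun_prop) (by fun_prop), runMeasure, Kernel.trajMeasure,
    Measure.map_comp _ _ (by fun_prop), Kernel.traj_map_frestrictLe, Kernel.partialTraj_self,
    Measure.id_comp, Measure.map_map (by fun_prop) (by fun_prop)]
  exact (congrArg (fun f => Measure.map f _) (funext fun x => rfl)).trans Measure.map_id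

/-- Tower property: the law of an initial segment composed with the kernel is the joint law of the
segment and the next pair. The empty segment is separate, as `stepKernel` starts from at least one
pair. -/
theorem lintegral_ofSeq_succ (G : MDP Q A) (σ : Strategy Q A) (q : Q) (F : FinRun Q A → ℝ≥0∞)
    (n : ℕ) :
    ∫⁻ ω, F (FinRun.ofSeq q ω (n + 1)) ∂G.runMeasure σ q =
      ∫⁻ ω, ∑' x : A × Q, G.stepDist σ (FinRun.ofSeq q ω n) x *
        F (.step (FinRun.ofSeq q ω n) x.1 x.2) ∂G.runMeasure σ q := by
  have hd (ρ : FinRun Q A) (g : A × Q → ℝ≥0∞) :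
      ∫⁻ x, g x ∂(G.stepDist σ ρ).toMeasure = ∑' x, G.stepDist σ ρ x * g x := by
    rw [lintegral_countable']
    simp_rw [PMF.toMeasure_apply_singleton _ _ (measurableSet_singleton _), mul_comm]
  cases n with
  | zero =>
    simp only [FinRun.ofSeq, lintegral_const, measure_univ, mul_one]
    rw [← hd _ fun x => F (.step (.start q) x.1 x.2), ← runMeasure_map_zero,
      lintegral_map .of_discrete (by fun_prop)]
  | succ n =>
    have key := Kernel.map_frestrictLe_trajMeasure_compProd_eq_map_trajMeasure
      (X := fun _ => A × Q) (μ₀ := (G.stepDist σ (FinRun.start q)).toMeasure)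
      (κ := G.stepKernel σ q) (a := n)
    rw [← runMeasure] at key
    let r (x : Π _ : Finset.Iic n, A × Q) : FinRun Q A :=
      FinRun.ofSeq q (fun i => x ⟨min i n, Finset.mem_Iic.2 (min_le_right i n)⟩) (n + 1)
    have hr (ω : ℕ → A × Q) : FinRun.ofSeq q ω (n + 1) = r (Preorder.frestrictLe n ω) :=
      FinRun.ofSeq_succ_eq_frestrictLe q ω n
    let g (y : (Π _ : Finset.Iic n, A × Q) × (A × Q)) : ℝ≥0∞ := F (.step (r y.1) y.2.1 y.2.2)
    have hg : Measurable g := .of_discrete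
    calc ∫⁻ ω, F (FinRun.ofSeq q ω (n + 1 + 1)) ∂G.runMeasure σ q
        = ∫⁻ ω, g (Preorder.frestrictLe n ω, ω (n + 1)) ∂G.runMeasure σ q := by
          refine lintegral_congr fun ω => ?_
          rw [FinRun.ofSeq, hr]
      _ = ∫⁻ x, ∑' y, G.stepDist σ (r x) y * g (x, y)
            ∂(G.runMeasure σ q).map (Preorder.frestrictLe n) := by
          rw [← lintegral_map (f := g) (g := fun ω : ℕ → A × Q =>
              (Preorder.frestrictLe (π := fun _ => A × Q) n ω, ω (n + 1))) hg (by fun_prop),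
            ← key, Measure.lintegral_compProd hg]
          refine lintegral_congr fun x => ?_
          rw [← hd]
          rfl
      _ = _ := by
          rw [lintegral_map .of_discrete (by fun_prop)]
          refine lintegral_congr fun ω => ?_
          rw [hr]

/-! ### Ville's inequality. -/

/-- Ville's maximal inequality for a nonnegative supermartingale on the finite runs. -/
theorem runMeasure_exists_le_of_supermartingale (G : MDP Q A) (σ : Strategy Q A) (q : Q)
    (S : FinRun Q A → ℝ≥0∞)
    (hS : ∀ ρ, ∑' x : A × Q, G.stepDist σ ρ x * S (.step ρ x.1 x.2) ≤ S ρ)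
    (B : Set (FinRun Q A)) (hB : ∀ ρ ∈ B, 1 ≤ S ρ) :
    G.runMeasure σ q {ω | ∃ n, FinRun.ofSeq q ω n ∈ B} ≤ S (.start q) := by
  classical
  -- The process is frozen at 1 once `B` is hit. It remains a supermartingale because `S ≥ 1` on
  -- `B`, so Markov's inequality at a fixed time covers all earlier hits.
  let V (ρ : FinRun Q A) : ℝ≥0∞ := if ∃ π ∈ B, π.IsPrefix ρ then 1 else S ρ
  have hself (ρ : FinRun Q A) : ρ.IsPrefix ρ := by
    cases ρ
    · rfl
    · exact Or.inl rfl
  have hVS (ρ a t) (h : ¬ ∃ π ∈ B, π.IsPrefix ρ) : V (.step ρ a t) ≤ S (.step ρ a t) := by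
    simp only [V]
    split_ifs with h'
    · obtain ⟨π, hπ, rfl | hp⟩ := h'
      · exact hB _ hπ
      · exact absurd ⟨π, hπ, hp⟩ h
    · exact le_rfl
  have hV (ρ : FinRun Q A) :
      ∑' x : A × Q, G.stepDist σ ρ x * V (.step ρ x.1 x.2) ≤ V ρ := by
    by_cases h : ∃ π ∈ B, π.IsPrefix ρ
    · have h1 (a t) : V (.step ρ a t) = 1 := by
        obtain ⟨π, hπ, hp⟩ := h
        exact if_pos ⟨π, hπ, Or.inr hp⟩
      have h2 : V ρ = 1 := if_pos h
      simp only [h1, h2, mul_one, PMF.tsum_coe, le_refl]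
    · have h2 : V ρ = S ρ := if_neg h
      rw [h2]
      exact (ENNReal.tsum_le_tsum fun x => mul_le_mul_right (hVS _ _ _ h) _).trans (hS ρ)
  have hint (n : ℕ) : ∫⁻ ω, V (FinRun.ofSeq q ω n) ∂G.runMeasure σ q ≤ S (.start q) := by
    induction n with
    | zero =>
      simp only [FinRun.ofSeq, lintegral_const, measure_univ, mul_one, V]
      split_ifs with h
      · obtain ⟨π, hπ, rfl⟩ := h
        exact hB _ hπ
      · exact le_rfl
    | succ n ih =>
      rw [lintegral_ofSeq_succ]
      exact (lintegral_mono fun ω => hV _).trans ih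
  have hpre (ω : ℕ → A × Q) {i n : ℕ} (h : i ≤ n) :
      (FinRun.ofSeq q ω i).IsPrefix (FinRun.ofSeq q ω n) := by
    induction n, h using Nat.le_induction with
    | base => exact hself _
    | succ n _ ih => exact Or.inr ih
  have hU : {ω | ∃ n, FinRun.ofSeq q ω n ∈ B} = ⋃ n, {ω | ∃ i ≤ n, FinRun.ofSeq q ω i ∈ B} := by
    ext ω
    simp only [Set.mem_ofPred_eq, Set.mem_iUnion]
    exact ⟨fun ⟨n, h⟩ => ⟨n, n, le_rfl, h⟩, fun ⟨_, i, _, h⟩ => ⟨i, h⟩⟩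
  have hmono : Monotone fun n => {ω : ℕ → A × Q | ∃ i ≤ n, FinRun.ofSeq q ω i ∈ B} :=
    fun n k hnk ω ⟨i, hi, h⟩ => ⟨i, hi.trans hnk, h⟩
  rw [hU, hmono.measure_iUnion]
  refine iSup_le fun n => ?_
  calc G.runMeasure σ q {ω | ∃ i ≤ n, FinRun.ofSeq q ω i ∈ B}
      ≤ G.runMeasure σ q {ω | 1 ≤ V (FinRun.ofSeq q ω n)} :=
        measure_mono fun ω ⟨i, hi, h⟩ => (if_pos ⟨_, h, hpre ω hi⟩ : V _ = 1).ge
    _ ≤ (∫⁻ ω, V (FinRun.ofSeq q ω n) ∂G.runMeasure σ q) / 1 :=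
        meas_ge_le_lintegral_div (measurable_comp_ofSeq V q n).aemeasurable one_ne_zero
          ENNReal.one_ne_top
    _ ≤ S (.start q) := by simpa using hint n

end MDP

/-! ### Bhattacharyya coefficient. -/

namespace PMF

variable {α : Type*}

theorem sum_toReal [Fintype α] (p : PMF α) : ∑ t, (p t).toReal = 1 := by
  rw [← ENNReal.toReal_sum fun t _ => p.apply_ne_top t, ← tsum_fintype (L := .unconditional _),
    p.tsum_coe, ENNReal.toReal_one]

/-- The Bhattacharyya coefficient of two distributions that differ by at least `η` at some point
is at most `1 - η² / 8`. -/
theorem sum_sqrt_mul_le [Fintype α] (p r : PMF α) (s : α) {η : ℝ} (hη : 0 ≤ η)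
    (h : η ≤ |(p s).toReal - (r s).toReal|) :
    ∑ t, √((p t).toReal * (r t).toReal) ≤ 1 - η ^ 2 / 8 := by
  have hx (t : α) : √((p t).toReal * (r t).toReal) =
      (p t).toReal / 2 + (r t).toReal / 2 - (√(p t).toReal - √(r t).toReal) ^ 2 / 2 := by
    rw [Real.sqrt_mul ENNReal.toReal_nonneg]
    have h1 := Real.sq_sqrt (ENNReal.toReal_nonneg (a := p t))
    have h2 := Real.sq_sqrt (ENNReal.toReal_nonneg (a := r t))
    linear_combination h1 / 2 + h2 / 2
  -- Only the Hellinger term at `s` is kept. Since `√p + √r ≤ 2`, `(√p - √r)² ≥ (p - r)² / 4`,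
  -- whence the constant 8.
  have hs : (√(p s).toReal - √(r s).toReal) ^ 2 / 2 ≤
      ∑ t, (√(p t).toReal - √(r t).toReal) ^ 2 / 2 :=
    Finset.single_le_sum (f := fun t => (√(p t).toReal - √(r t).toReal) ^ 2 / 2)
      (fun t _ => by positivity) (Finset.mem_univ s)
  have hle (u : PMF α) : √(u s).toReal ≤ 1 :=
    Real.sqrt_le_one.2 (ENNReal.toReal_mono ENNReal.one_ne_top (u.coe_le_one s))
  have hη2 : η ^ 2 ≤ ((p s).toReal - (r s).toReal) ^ 2 := by
    rw [← sq_abs ((p s).toReal - _)]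
    exact pow_le_pow_left₀ hη h 2
  have hfac : ((p s).toReal - (r s).toReal) ^ 2 =
      (√(p s).toReal - √(r s).toReal) ^ 2 * (√(p s).toReal + √(r s).toReal) ^ 2 := by
    rw [← mul_pow, mul_comm, ← sq_sub_sq, Real.sq_sqrt ENNReal.toReal_nonneg,
      Real.sq_sqrt ENNReal.toReal_nonneg]
  have h4 : (√(p s).toReal + √(r s).toReal) ^ 2 ≤ 2 ^ 2 :=
    pow_le_pow_left₀ (by positivity) (by linarith [hle p, hle r]) 2
  have h5 := mul_le_mul_of_nonneg_left h4 (sq_nonneg (√(p s).toReal - √(r s).toReal))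
  simp_rw [hx, Finset.sum_sub_distrib, Finset.sum_add_distrib, ← Finset.sum_div, sum_toReal]
  rw [← Finset.sum_div] at hs
  linarith

theorem tsum_sqrt_mul_le [Fintype α] (p r : PMF α) (s : α) {η : ℝ} (hη : 0 ≤ η)
    (h : η ≤ |(p s).toReal - (r s).toReal|) :
    ∑' t, (p t * r t) ^ (1 / 2 : ℝ) ≤ ENNReal.ofReal (1 - η ^ 2 / 8) := by
  refine le_trans ?_ (ENNReal.ofReal_le_ofReal (sum_sqrt_mul_le p r s hη h))
  rw [tsum_fintype, ENNReal.ofReal_sum_of_nonneg fun _ _ => Real.sqrt_nonneg _]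
  refine Finset.sum_le_sum fun t _ => ?_
  rw [Real.sqrt_eq_rpow, ← ENNReal.ofReal_rpow_of_nonneg (by positivity) (by norm_num),
    ENNReal.ofReal_mul ENNReal.toReal_nonneg, ENNReal.ofReal_toReal (p.apply_ne_top t),
    ENNReal.ofReal_toReal (r.apply_ne_top t)]

end PMF

/-! ### Likelihood supermartingale and beliefs. -/

namespace MDP

theorem stepDist_apply {Q A : Type*} (G : MDP Q A) (σ : Strategy Q A) (ρ : FinRun Q A)
    (x : A × Q) : G.stepDist σ ρ x = σ ρ x.1 * G.δ ρ.head x.1 x.2 := by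
  classical
  obtain ⟨a, t⟩ := x
  rw [stepDist, PMF.bind_apply, tsum_eq_single a]
  · rw [PMF.map_apply, tsum_eq_single t]
    · simp
    · intro t' h
      simp [h.symm]
  · intro a' h
    rw [PMF.map_apply]
    simp [h.symm]

end MDP

namespace MEMDP

variable {Q A E : Type*}

open Classical in
/-- The number of transitions of a finite run that leave from an `(e, f)`-distinguishing
state-action pair. -/
noncomputable def nbDstgPair (Γ : MEMDP Q A E) (e f : E) : FinRun Q A → ℕ
  | .start _ => 0
  | .step ρ a _ => Γ.nbDstgPair e f ρ + if (ρ.head, a) ∈ Γ.dstgPair e f then 1 else 0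

open Classical in
/-- The square root of the likelihood ratio of `f` and `e` for a transition, amplified by `γ` at
`(e, f)`-distinguishing pairs; it is infinite if the transition is impossible in `e`. -/
noncomputable def sqrtRatio (Γ : MEMDP Q A E) (e f : E) (γ : ℝ≥0∞) (q : Q) (a : A) (t : Q) :
    ℝ≥0∞ :=
  if Γ.δ e q a t = 0 then ⊤
  else (Γ.δ f q a t / Γ.δ e q a t) ^ (1 / 2 : ℝ) * if (q, a) ∈ Γ.dstgPair e f then γ else 1

/-- The product of the amplified square roots of the likelihood ratios along a finite run. -/
noncomputable def sqrtLikelihood (Γ : MEMDP Q A E) (e f : E) (γ : ℝ≥0∞) : FinRun Q A → ℝ≥0∞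
  | .start _ => 1
  | .step ρ a t => Γ.sqrtLikelihood e f γ ρ * Γ.sqrtRatio e f γ ρ.head a t

theorem tsum_mul_sqrtRatio_le_one (Γ : MEMDP Q A E) (e f : E) {γ : ℝ≥0∞} (q : Q) (a : A)
    (hγ : (q, a) ∈ Γ.dstgPair e f →
      (∑' t, (Γ.δ e q a t * Γ.δ f q a t) ^ (1 / 2 : ℝ)) * γ ≤ 1) :
    ∑' t, Γ.δ e q a t * Γ.sqrtRatio e f γ q a t ≤ 1 := by
  classical
  have hsq (x : ℝ≥0∞) : (x * x) ^ (1 / 2 : ℝ) = x := by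
    rw [← sq, ← ENNReal.rpow_natCast, ← ENNReal.rpow_mul]
    norm_num
  have hterm (t : Q) : Γ.δ e q a t * Γ.sqrtRatio e f γ q a t ≤
      (Γ.δ e q a t * Γ.δ f q a t) ^ (1 / 2 : ℝ) *
        if (q, a) ∈ Γ.dstgPair e f then γ else 1 := by
    unfold sqrtRatio
    split_ifs with h0 h1 h1
    -- `0 * ⊤ = 0`: the infinite value at impossible transitions does not affect the mean.
    · simp [h0]
    · simp [h0]
    all_goals
      rw [← mul_assoc]
      refine mul_le_mul_left (le_of_eq ?_) _
      nth_rw 1 [← hsq (Γ.δ e q a t)]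
      rw [← ENNReal.mul_rpow_of_nonneg _ _ (by norm_num), mul_assoc,
        ENNReal.mul_div_cancel h0 (PMF.apply_ne_top _ _)]
  refine (ENNReal.tsum_le_tsum hterm).trans ?_
  rw [ENNReal.tsum_mul_right]
  split_ifs with h
  · exact hγ h
  · have h' : Γ.δ e q a = Γ.δ f q a := not_not.1 h
    simp only [← h', hsq, PMF.tsum_coe, mul_one, le_refl]

theorem tsum_stepDist_mul_sqrtLikelihood_le (Γ : MEMDP Q A E) (e f : E) {γ : ℝ≥0∞}
    (hγ : ∀ q a, (q, a) ∈ Γ.dstgPair e f →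
      (∑' t, (Γ.δ e q a t * Γ.δ f q a t) ^ (1 / 2 : ℝ)) * γ ≤ 1)
    (σ : Strategy Q A) (ρ : FinRun Q A) :
    ∑' x : A × Q, (Γ.env e).stepDist σ ρ x * Γ.sqrtLikelihood e f γ (.step ρ x.1 x.2) ≤
      Γ.sqrtLikelihood e f γ ρ := by
  simp only [MDP.stepDist_apply, env, sqrtLikelihood]
  rw [ENNReal.tsum_prod']
  calc ∑' a, ∑' t, σ ρ a * Γ.δ e ρ.head a t *
          (Γ.sqrtLikelihood e f γ ρ * Γ.sqrtRatio e f γ ρ.head a t)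
      = ∑' a, σ ρ a * Γ.sqrtLikelihood e f γ ρ *
          ∑' t, Γ.δ e ρ.head a t * Γ.sqrtRatio e f γ ρ.head a t := by
        simp_rw [← ENNReal.tsum_mul_left]
        exact tsum_congr fun a => tsum_congr fun t => by ring
    _ ≤ ∑' a, σ ρ a * Γ.sqrtLikelihood e f γ ρ * 1 := ENNReal.tsum_le_tsum fun a =>
        mul_le_mul_right (Γ.tsum_mul_sqrtRatio_le_one e f _ a (hγ _ a)) _
    _ = Γ.sqrtLikelihood e f γ ρ := by
        simp only [mul_one]
        rw [ENNReal.tsum_mul_right, PMF.tsum_coe, one_mul]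

theorem neverSmallBelief_of_step {Γ : MEMDP Q A E} {b : PMF E} {ε : ℝ} {ρ : FinRun Q A} {a : A}
    {t : Q} (h : .step ρ a t ∈ Γ.neverSmallBelief b ε) : ρ ∈ Γ.neverSmallBelief b ε :=
  fun π hπ e => h π (Or.inr hπ) e

theorem lt_lk_of_mem_neverSmallBelief {Γ : MEMDP Q A E} {b : PMF E} {ε : ℝ} {ρ : FinRun Q A}
    (h : ρ ∈ Γ.neverSmallBelief b ε) (e : E) : ENNReal.ofReal ε < Γ.lk b ρ e :=
  h ρ (by cases ρ with
    | start => rfl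
    | step => exact Or.inl rfl) e

theorem lt_prior_of_mem_neverSmallBelief {Γ : MEMDP Q A E} {b : PMF E} {ε : ℝ} {ρ : FinRun Q A}
    (h : ρ ∈ Γ.neverSmallBelief b ε) (e : E) : ENNReal.ofReal ε < b e := by
  induction ρ with
  | start => exact lt_lk_of_mem_neverSmallBelief h e
  | step ρ a t ih => exact ih (neverSmallBelief_of_step h)

/-- Bayes' rule for odds, cleared of denominators; the normalisation cancels between `e` and `f`.
The exponent doubles because `sqrtLikelihood` is squared. -/
theorem lk_mul_le_sqrtLikelihood (Γ : MEMDP Q A E) (b : PMF E) (e f : E) {γ : ℝ≥0∞} (hγ : 1 ≤ γ)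
    {ε : ℝ} {ρ : FinRun Q A} (h : ρ ∈ Γ.neverSmallBelief b ε) :
    Γ.lk b ρ f * b e * γ ^ (2 * Γ.nbDstgPair e f ρ) ≤
      Γ.lk b ρ e * b f * Γ.sqrtLikelihood e f γ ρ ^ 2 := by
  classical
  induction ρ with
  | start q => simp [lk, nbDstgPair, sqrtLikelihood, mul_comm]
  | step ρ a t ih =>
    have hρ := neverSmallBelief_of_step h
    have ih := ih hρ
    have hpos (g : E) : Γ.lk b ρ g ≠ 0 := (bot_lt_of_lt (lt_lk_of_mem_neverSmallBelief hρ g)).ne'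
    have hpos' (g : E) : Γ.lk b (.step ρ a t) g ≠ 0 :=
      (bot_lt_of_lt (lt_lk_of_mem_neverSmallBelief h g)).ne'
    have hprior (g : E) : b g ≠ 0 := (bot_lt_of_lt (lt_prior_of_mem_neverSmallBelief hρ g)).ne'
    have hγ0 : γ ≠ 0 := (one_pos.trans_le hγ).ne'
    by_cases he : Γ.δ e ρ.head a t = 0
    -- A transition impossible in `e` may survive in the set, since the belief is left unchanged
    -- when the denominator is 0. The bound is then trivial through the value `⊤`, provided the
    -- previous factor is nonzero.
    · have hS : Γ.sqrtLikelihood e f γ ρ ≠ 0 := by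
        intro h0
        rw [h0] at ih
        simp [hpos, hprior, hγ0] at ih
      have : Γ.sqrtLikelihood e f γ (.step ρ a t) = ⊤ := by
        simp [sqrtLikelihood, sqrtRatio, he, hS]
      rw [this, ENNReal.top_pow two_ne_zero, ENNReal.mul_top (mul_ne_zero (hpos' e) (hprior f))]
      exact le_top
    · have hs : Γ.succDist (Γ.lk b ρ) ρ.head a t ≠ 0 := by
        rw [succDist, PMF.bind_apply]
        exact fun h0 => mul_ne_zero (hpos e) he (ENNReal.tsum_eq_zero.1 h0 e)
      have hlk (g : E) : Γ.lk b (.step ρ a t) g =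
          Γ.lk b ρ g * Γ.δ g ρ.head a t / Γ.succDist (Γ.lk b ρ) ρ.head a t := by
        rw [lk, beliefUpdate]
        exact DFunLike.congr_fun (dif_neg hs) g
      have hsq (x : ℝ≥0∞) : (x ^ (1 / 2 : ℝ)) ^ 2 = x := by
        rw [← ENNReal.rpow_natCast, ← ENNReal.rpow_mul]
        norm_num
      let g : ℝ≥0∞ := if (ρ.head, a) ∈ Γ.dstgPair e f then γ else 1
      have hN : γ ^ (2 * Γ.nbDstgPair e f (.step ρ a t)) =
          γ ^ (2 * Γ.nbDstgPair e f ρ) * g ^ 2 := by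
        simp only [nbDstgPair, g]
        split_ifs
        · ring
        · simp
      have hS : Γ.sqrtLikelihood e f γ (.step ρ a t) ^ 2 = Γ.sqrtLikelihood e f γ ρ ^ 2 *
          (Γ.δ f ρ.head a t / Γ.δ e ρ.head a t * g ^ 2) := by
        rw [sqrtLikelihood, sqrtRatio, if_neg he, mul_pow, mul_pow, hsq]
      rw [hN, hS, hlk, hlk, div_eq_mul_inv, div_eq_mul_inv]
      set s := (Γ.succDist (Γ.lk b ρ) ρ.head a t)⁻¹
      calc Γ.lk b ρ f * Γ.δ f ρ.head a t * s * b e * (γ ^ (2 * Γ.nbDstgPair e f ρ) * g ^ 2)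
          = Γ.lk b ρ f * b e * γ ^ (2 * Γ.nbDstgPair e f ρ) *
              (Γ.δ f ρ.head a t * s * g ^ 2) := by ring
        _ ≤ Γ.lk b ρ e * b f * Γ.sqrtLikelihood e f γ ρ ^ 2 *
              (Γ.δ f ρ.head a t * s * g ^ 2) := mul_le_mul_left ih _
        _ = Γ.lk b ρ e * b f * Γ.sqrtLikelihood e f γ ρ ^ 2 *
              (Γ.δ e ρ.head a t * (Γ.δ f ρ.head a t / Γ.δ e ρ.head a t) * s * g ^ 2) := by
            rw [ENNReal.mul_div_cancel he (PMF.apply_ne_top _ _)]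
        _ = _ := by ring

theorem mul_pow_le_sqrtLikelihood (Γ : MEMDP Q A E) (b : PMF E) (e f : E) {γ : ℝ≥0∞} (hγ : 1 ≤ γ)
    {ε : ℝ} {ρ : FinRun Q A} (h : ρ ∈ Γ.neverSmallBelief b ε) :
    ENNReal.ofReal ε * γ ^ Γ.nbDstgPair e f ρ ≤ Γ.sqrtLikelihood e f γ ρ := by
  rw [← ENNReal.pow_le_pow_left_iff two_ne_zero]
  calc (ENNReal.ofReal ε * γ ^ Γ.nbDstgPair e f ρ) ^ 2
      = ENNReal.ofReal ε * ENNReal.ofReal ε * γ ^ (2 * Γ.nbDstgPair e f ρ) := by ring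
    _ ≤ Γ.lk b ρ f * b e * γ ^ (2 * Γ.nbDstgPair e f ρ) :=
        mul_le_mul_left (mul_le_mul' (lt_lk_of_mem_neverSmallBelief h f).le
          (lt_prior_of_mem_neverSmallBelief h e).le) _
    _ ≤ Γ.lk b ρ e * b f * Γ.sqrtLikelihood e f γ ρ ^ 2 := Γ.lk_mul_le_sqrtLikelihood b e f hγ h
    _ ≤ 1 * 1 * Γ.sqrtLikelihood e f γ ρ ^ 2 :=
        mul_le_mul_left (mul_le_mul' (PMF.coe_le_one _ _) (PMF.coe_le_one _ _)) _
    _ = _ := by ring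

variable [Finite Q] [Finite A] [MeasurableSpace Q] [DiscreteMeasurableSpace Q]
  [MeasurableSpace A] [DiscreteMeasurableSpace A]

theorem runMeasure_nbDstgPair_le (Γ : MEMDP Q A E) (b : PMF E) (e f : E) {γ : ℝ≥0∞} (h1 : 1 ≤ γ)
    (hγt : γ ≠ ⊤) (hγ : ∀ q a, (q, a) ∈ Γ.dstgPair e f →
      (∑' t, (Γ.δ e q a t * Γ.δ f q a t) ^ (1 / 2 : ℝ)) * γ ≤ 1)
    {ε : ℝ} (hε : 0 < ε) (q : Q) (σ : Strategy Q A) (m : ℕ) :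
    (Γ.env e).runMeasure σ q {ω | ∃ n, FinRun.ofSeq q ω n ∈
      {ρ | m ≤ Γ.nbDstgPair e f ρ ∧ ρ ∈ Γ.neverSmallBelief b ε}} ≤
        (ENNReal.ofReal ε * γ ^ m)⁻¹ := by
  have h0 : ENNReal.ofReal ε * γ ^ m ≠ 0 :=
    mul_ne_zero (ENNReal.ofReal_pos.2 hε).ne' (pow_ne_zero _ (one_pos.trans_le h1).ne')
  have ht : ENNReal.ofReal ε * γ ^ m ≠ ⊤ :=
    ENNReal.mul_ne_top ENNReal.ofReal_ne_top (ENNReal.pow_ne_top hγt)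
  refine ((Γ.env e).runMeasure_exists_le_of_supermartingale σ q
    (fun ρ => (ENNReal.ofReal ε * γ ^ m)⁻¹ * Γ.sqrtLikelihood e f γ ρ) (fun ρ => ?_) _
    fun ρ hρ => ?_).trans ?_
  · simp_rw [mul_left_comm _ (ENNReal.ofReal ε * γ ^ m)⁻¹]
    rw [ENNReal.tsum_mul_left]
    exact mul_le_mul_right (Γ.tsum_stepDist_mul_sqrtLikelihood_le e f hγ σ ρ) _
  · rw [← ENNReal.inv_mul_cancel h0 ht]
    exact mul_le_mul_right ((mul_le_mul_right (pow_le_pow_right₀ h1 hρ.1) _).trans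
      (Γ.mul_pow_le_sqrtLikelihood b e f h1 hρ.2)) _
  · simp [sqrtLikelihood]

end MEMDP

/-! ### Separation of probabilities and the numerical bound. -/

theorem exists_nnrat_of_bitLength_le {p : ℝ≥0∞} {l : ℕ} (h : bitLength p ≤ l) :
    ∃ r : ℚ≥0, ((r : ℝ≥0) : ℝ≥0∞) = p ∧ r.den ≤ 2 ^ l := by
  -- A strict bound lets a witness be drawn from the infimum.
  have h' : bitLength p < ((l + 1 : ℕ) : ℕ∞) := h.trans_lt (by exact_mod_cast l.lt_succ_self)
  simp only [bitLength, iInf_lt_iff] at h'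
  obtain ⟨r, hr, hlt⟩ := h'
  have hlt : Nat.size r.num + Nat.size r.den < l + 1 := by exact_mod_cast hlt
  exact ⟨r, hr, (Nat.lt_size_self r.den).le.trans (Nat.pow_le_pow_right two_pos (by omega))⟩

theorem NNRat.one_le_mul_abs_sub {r s : ℚ≥0} (h : r ≠ s) {D : ℕ} (hr : r.den ≤ D)
    (hs : s.den ≤ D) : (1 : ℝ) ≤ (D ^ 2 : ℕ) * |(r : ℝ) - (s : ℝ)| := by
  have hrd : (0 : ℝ) < r.den := by exact_mod_cast r.den_pos
  have hsd : (0 : ℝ) < s.den := by exact_mod_cast s.den_pos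
  have hr' : (r : ℝ) = r.num / r.den := by rw [NNRat.cast_def]
  have hs' : (s : ℝ) = s.num / s.den := by rw [NNRat.cast_def]
  have hne : (r : ℝ) - s ≠ 0 := sub_ne_zero.2 (by exact_mod_cast h)
  have hz : ((r.den * s.den : ℕ) : ℝ) * |(r : ℝ) - s| =
      ((|(r.num * s.den - s.num * r.den : ℤ)| : ℤ) : ℝ) := by
    rw [← abs_of_pos (show (0 : ℝ) < (r.den * s.den : ℕ) by push_cast; positivity), ← abs_mul,
      hr', hs']
    push_cast
    congr 1
    field_simp
  have hpos : (0 : ℝ) < (r.den * s.den : ℕ) * |(r : ℝ) - s| :=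
    mul_pos (by push_cast; positivity) (abs_pos.2 hne)
  have h1 : (1 : ℝ) ≤ ((r.den * s.den : ℕ) : ℝ) * |(r : ℝ) - s| := by
    rw [hz] at hpos ⊢
    exact_mod_cast (show (0 : ℤ) < _ by exact_mod_cast hpos)
  refine h1.trans (mul_le_mul_of_nonneg_right ?_ (abs_nonneg _))
  rw [sq]
  exact_mod_cast Nat.mul_le_mul hr hs

namespace MEMDP

variable {Q A E : Type*}

theorem bitLength_le_maxBits (Γ : MEMDP Q A E) (e : E) (q : Q) (a : A) (t : Q) :
    bitLength (Γ.δ e q a t) ≤ Γ.maxBits :=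
  (le_iSup (fun t => bitLength (Γ.δ e q a t)) t).trans <|
    (le_iSup (fun a => ⨆ t, bitLength (Γ.δ e q a t)) a).trans <|
    (le_iSup (fun q => ⨆ (a) (t), bitLength (Γ.δ e q a t)) q).trans <|
    le_iSup (fun e => ⨆ (q) (a) (t), bitLength (Γ.δ e q a t)) e

/-- `1 / D` serves as the gap `η`. With finite bit length it comes from the denominators of distinct
fractions; otherwise finiteness of `Γ` gives some gap. -/
theorem exists_resolution [Finite Q] [Finite A] [Finite E] (Γ : MEMDP Q A E) : ∃ D : ℕ, 0 < D ∧
    (∀ l : ℕ, Γ.maxBits = l → D ≤ (2 ^ l) ^ 2) ∧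
    ∀ e f q a t, Γ.δ e q a t ≠ Γ.δ f q a t →
      (1 : ℝ) ≤ D * |(Γ.δ e q a t).toReal - (Γ.δ f q a t).toReal| := by
  by_cases hl : ∃ l : ℕ, Γ.maxBits = l
  · obtain ⟨l, hl⟩ := hl
    refine ⟨(2 ^ l) ^ 2, by positivity, fun l' hl' => ?_, fun e f q a t h => ?_⟩
    · rw [hl, Nat.cast_inj] at hl'
      rw [hl']
    · obtain ⟨r, hr, hrd⟩ :=
        exists_nnrat_of_bitLength_le ((Γ.bitLength_le_maxBits e q a t).trans hl.le)
      obtain ⟨s, hs, hsd⟩ :=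
        exists_nnrat_of_bitLength_le ((Γ.bitLength_le_maxBits f q a t).trans hl.le)
      rw [← hr, ← hs] at h ⊢
      have := NNRat.one_le_mul_abs_sub (fun hrs => h (by rw [hrs])) hrd hsd
      have hcast (u : ℚ≥0) : (((u : ℝ≥0) : ℝ≥0∞)).toReal = (u : ℝ) :=
        map_nnratCast NNReal.toRealHom u
      rwa [hcast, hcast]
  · let g (x : E × E × Q × A × Q) : ℝ :=
      |(Γ.δ x.1 x.2.2.1 x.2.2.2.1 x.2.2.2.2).toReal -
        (Γ.δ x.2.1 x.2.2.1 x.2.2.2.1 x.2.2.2.2).toReal|⁻¹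
    obtain ⟨C, hC⟩ := (Set.finite_range g).bddAbove
    refine ⟨⌈C⌉₊ + 1, by omega, fun l h => absurd ⟨l, h⟩ hl, fun e f q a t h => ?_⟩
    have hne : 0 < |(Γ.δ e q a t).toReal - (Γ.δ f q a t).toReal| :=
      abs_pos.2 (sub_ne_zero.2 fun h' => h
        ((ENNReal.toReal_eq_toReal_iff' (PMF.apply_ne_top _ _) (PMF.apply_ne_top _ _)).1 h'))
    have h1 : g (e, f, q, a, t) ≤ ((⌈C⌉₊ + 1 : ℕ) : ℝ) := by
      have := hC (Set.mem_range_self (e, f, q, a, t))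
      push_cast
      linarith [Nat.le_ceil C]
    calc (1 : ℝ) = g (e, f, q, a, t) * |(Γ.δ e q a t).toReal - (Γ.δ f q a t).toReal| :=
          (inv_mul_cancel₀ hne.ne').symm
      _ ≤ _ := mul_le_mul_of_nonneg_right h1 hne.le

end MEMDP

/-- The number `8 D² (2 x + k)` of amplifications by `(1 - 1 / (8 D²))⁻¹` brings the failure
probability `1 / ε` down to `ε / k`. -/
theorem inv_mul_pow_le {D k : ℕ} (hD : 0 < D) (hk : 0 < k) {ε : ℝ} (hε : 0 < ε) :
    (ENNReal.ofReal ε * ENNReal.ofReal (1 - (1 / D : ℝ) ^ 2 / 8)⁻¹ ^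
      (8 * D ^ 2 * (2 * ⌈Real.logb 2 (1 / ε)⌉₊ + k)))⁻¹ ≤ ENNReal.ofReal (ε / k) := by
  set x := ⌈Real.logb 2 (1 / ε)⌉₊
  set c : ℝ := (1 / D : ℝ) ^ 2 / 8 with hc
  set n := 8 * D ^ 2 * (2 * x + k)
  have hD' : (0 : ℝ) < D := by exact_mod_cast hD
  have hk' : (0 : ℝ) < k := by exact_mod_cast hk
  have hc1 : c ≤ 1 / 8 := by
    have : (1 / D : ℝ) ≤ 1 := (div_le_one hD').2 (by exact_mod_cast hD)
    have := pow_le_one₀ (n := 2) (by positivity) this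
    rw [hc]
    linarith
  have h0 : 0 < 1 - c := by linarith
  -- As `(1 - c)⁻¹ ≥ exp c`, the power is at least `exp (2 x + k) ≥ 4 ^ x * k ≥ k / ε²`.
  have hcn : c * n = 2 * x + k := by
    simp only [hc, n]
    push_cast
    field_simp
  have hxε : 1 ≤ ε * 2 ^ x := by
    have h1 : 1 / ε ≤ (2 : ℝ) ^ (x : ℝ) :=
      (Real.logb_le_iff_le_rpow one_lt_two (by positivity)).1 (Nat.le_ceil _)
    rwa [Real.rpow_natCast, div_le_iff₀' hε] at h1
  have h2e : (2 : ℝ) ≤ Real.exp 1 := by linarith [Real.add_one_le_exp (1 : ℝ)]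
  have hexp : (k : ℝ) * (2 ^ x) ^ 2 ≤ Real.exp (c * n) := by
    have h1 : (k : ℝ) ≤ Real.exp k := by linarith [Real.add_one_le_exp (k : ℝ)]
    have h2 : ((2 : ℝ) ^ x) ^ 2 ≤ Real.exp (2 * x) := by
      calc ((2 : ℝ) ^ x) ^ 2 = 2 ^ (2 * x) := by rw [← pow_mul, mul_comm]
        _ ≤ Real.exp 1 ^ (2 * x) := pow_le_pow_left₀ two_pos.le h2e _
        _ = Real.exp (2 * x) := by rw [← Real.exp_nat_mul]; push_cast; rw [mul_one]
    rw [hcn, add_comm, Real.exp_add]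
    exact mul_le_mul h1 h2 (by positivity) (Real.exp_nonneg _)
  have hγ : Real.exp (c * n) ≤ (1 - c)⁻¹ ^ n := by
    rw [mul_comm, Real.exp_nat_mul]
    refine pow_le_pow_left₀ (Real.exp_nonneg _) ?_ _
    rw [← inv_inv (Real.exp c), ← Real.exp_neg]
    exact inv_anti₀ h0 (by linarith [Real.add_one_le_exp (-c)])
  rw [← ENNReal.ofReal_pow (inv_nonneg.2 h0.le), ← ENNReal.ofReal_mul hε.le,
    ← ENNReal.ofReal_inv_of_pos (by positivity)]
  refine ENNReal.ofReal_le_ofReal ?_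
  rw [inv_le_comm₀ (by positivity) (by positivity), inv_div, div_le_iff₀ hε]
  have h3 : (1 : ℝ) ≤ (ε * 2 ^ x) ^ 2 := one_le_pow₀ hxε
  calc (k : ℝ) ≤ k * (ε * 2 ^ x) ^ 2 := le_mul_of_one_le_right hk'.le h3
    _ = ε * (k * (2 ^ x) ^ 2) * ε := by ring
    _ ≤ ε * (1 - c)⁻¹ ^ n * ε := by gcongr; exact hexp.trans hγ

/-! ### Counting visits and conclusion. -/

namespace MEMDP

variable {Q A E : Type*}

/-- If `e` agreed with every environment at a pair, all would agree there; so each distinguishing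
pair separates `e` itself from some `f`, and only `k` rivals need be considered. -/
theorem nbDstgFin_le_sum (Γ : MEMDP Q A E) [Fintype E] (e : E) (ρ : FinRun Q A) :
    Γ.nbDstgFin ρ ≤ ∑ f, Γ.nbDstgPair e f ρ := by
  classical
  induction ρ with
  | start => simp [nbDstgFin]
  | step ρ a t ih =>
    simp only [nbDstgFin, nbDstgPair, Finset.sum_add_distrib]
    refine add_le_add ih ?_
    split_ifs with h
    · obtain ⟨g, g', -, h⟩ := h
      have : ∃ f, (ρ.head, a) ∈ Γ.dstgPair e f := by
        by_contra! hno
        exact h ((not_not.1 (hno g)).symm.trans (not_not.1 (hno g')))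
      obtain ⟨f, hf⟩ := this
      refine le_trans (by rw [if_pos hf])
        (Finset.single_le_sum (fun _ _ => Nat.zero_le _) (Finset.mem_univ f))
    · exact Nat.zero_le _

theorem exists_le_nbDstgFin (Γ : MEMDP Q A E) (q : Q) (ω : ℕ → A × Q) (m : ℕ)
    (h : (m : ℕ∞) ≤ Γ.nbDstg q ω) : ∃ n, m ≤ Γ.nbDstgFin (FinRun.ofSeq q ω n) := by
  classical
  have hcount (n : ℕ) : Γ.nbDstgFin (FinRun.ofSeq q ω n) =
      ((Finset.range n).filter fun i => ((FinRun.ofSeq q ω i).head, (ω i).1) ∈ Γ.dstg).card := by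
    induction n with
    | zero => simp [FinRun.ofSeq, nbDstgFin]
    | succ n ih =>
      rw [FinRun.ofSeq, nbDstgFin, ih, Finset.range_add_one, Finset.filter_insert]
      split_ifs
      · rw [Finset.card_insert_of_notMem (by simp)]
      · rfl
  -- The count may be infinite, so `m` visit times are selected; a visit at time `i` is counted
  -- after `i + 1` transitions.
  obtain ⟨T, hT, hTm⟩ := Set.exists_subset_encard_eq h
  have hfin : T.Finite := Set.finite_of_encard_eq_coe hTm
  obtain ⟨N, hN⟩ := hfin.bddAbove
  refine ⟨N + 1, ?_⟩
  rw [hcount]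
  rw [hfin.encard_eq_coe_toFinset_card, Nat.cast_inj] at hTm
  rw [← hTm]
  refine Finset.card_le_card fun i hi => ?_
  have hi := hfin.mem_toFinset.1 hi
  simpa using ⟨hN hi, hT hi⟩

end MEMDP

theorem MEMDP.tsum_sqrt_mul_inv_le_one {Q A E : Type*} [Fintype Q] (Γ : MEMDP Q A E) {D : ℕ}
    (hD : 0 < D) (h : ∀ e f q a t, Γ.δ e q a t ≠ Γ.δ f q a t →
      (1 : ℝ) ≤ D * |(Γ.δ e q a t).toReal - (Γ.δ f q a t).toReal|)
    (e f : E) (q : Q) (a : A) (hq : (q, a) ∈ Γ.dstgPair e f) :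
    (∑' t, (Γ.δ e q a t * Γ.δ f q a t) ^ (1 / 2 : ℝ)) *
      ENNReal.ofReal (1 - (1 / D : ℝ) ^ 2 / 8)⁻¹ ≤ 1 := by
  obtain ⟨t, ht⟩ : ∃ t, Γ.δ e q a t ≠ Γ.δ f q a t := by
    by_contra! hno
    exact hq (PMF.ext hno)
  have hD' : (0 : ℝ) < D := by exact_mod_cast hD
  have hpos : 0 < 1 - (1 / D : ℝ) ^ 2 / 8 := by
    have h1 : (1 / D : ℝ) ≤ 1 := (div_le_one hD').2 (by exact_mod_cast hD)
    linarith [pow_le_one₀ (n := 2) (by positivity) h1]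
  refine (mul_le_mul_left (PMF.tsum_sqrt_mul_le _ _ t (one_div_nonneg.2 hD'.le)
    ((div_le_iff₀' hD').2 (h e f q a t ht))) _).trans ?_
  rw [← ENNReal.ofReal_mul hpos.le, mul_inv_cancel₀ hpos.ne', ENNReal.ofReal_one]

theorem mainTheorem6 :
    ∃ P : MvPolynomial (Fin 3) ℕ,
      ∀ (Q : Type*) (A : Type*) (E : Type*) [Fintype Q] [Fintype A] [Fintype E]
        [Nonempty Q] [Nonempty A] [Nonempty E]
        [MeasurableSpace Q] [DiscreteMeasurableSpace Q]
        [MeasurableSpace A] [DiscreteMeasurableSpace A]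
        (Γ : MEMDP Q A E) (ε : ℝ), 0 < ε →
        ∃ m : ℕ,
          (∀ l : ℕ, Γ.maxBits = (l : ℕ∞) →
            m ≤ MvPolynomial.eval ![Fintype.card E, 2 ^ l, ⌈Real.logb 2 (1 / ε)⌉₊] P) ∧
          ∀ (b : PMF E) (q : Q) (σ : Strategy Q A) (e : E),
            (Γ.env e).runMeasure σ q
                {ω | (m : ℕ∞) ≤ Γ.nbDstg q ω ∧
                  ∀ n : ℕ, FinRun.ofSeq q ω n ∈ Γ.neverSmallBelief b ε} ≤ ENNReal.ofReal ε ∧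
            (Γ.env e).runMeasure σ q
                {ω | ∃ n : ℕ, m ≤ Γ.nbDstgFin (FinRun.ofSeq q ω n) ∧
                  FinRun.ofSeq q ω n ∈ Γ.neverSmallBelief b ε} ≤ ENNReal.ofReal ε := by
  -- This is `k * N` with `N = 8 D² (2 x + k)` and `D` replaced by its bound `(2 ^ l)²`.
  refine ⟨.X 0 * (8 * ((.X 1) ^ 2) ^ 2 * (2 * .X 2 + .X 0)), ?_⟩
  intro Q A E _ _ _ _ _ _ _ _ _ _ Γ ε hε
  obtain ⟨D, hD, hDl, hsep⟩ := Γ.exists_resolution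
  set k := Fintype.card E with hk
  have hk0 : 0 < k := Fintype.card_pos
  set x := ⌈Real.logb 2 (1 / ε)⌉₊ with hx
  set N := 8 * D ^ 2 * (2 * x + k) with hN
  refine ⟨k * N, fun l hl => ?_, fun b q σ e => ?_⟩
  · have h8 : MvPolynomial.eval ![k, 2 ^ l, x] (8 : MvPolynomial (Fin 3) ℕ) = 8 := map_ofNat _ 8
    have h2 : MvPolynomial.eval ![k, 2 ^ l, x] (2 : MvPolynomial (Fin 3) ℕ) = 2 := map_ofNat _ 2
    simp only [map_mul, map_add, map_pow, MvPolynomial.eval_X, h8, h2, Matrix.cons_val]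
    rw [hN]
    gcongr
    exact hDl l hl
  set γ := ENNReal.ofReal (1 - (1 / D : ℝ) ^ 2 / 8)⁻¹
  have hγ1 : 1 ≤ γ := by
    have hD' : (1 : ℝ) ≤ D := by exact_mod_cast hD
    have h1 : (1 / D : ℝ) ≤ 1 := (div_le_one (by linarith)).2 hD'
    have h2 := pow_le_one₀ (n := 2) (by positivity) h1
    exact ENNReal.one_le_ofReal.2
      ((one_le_inv₀ (by linarith)).2 (by linarith [sq_nonneg (1 / D : ℝ)]))
  have hfin : (Γ.env e).runMeasure σ q
      {ω | ∃ n : ℕ, k * N ≤ Γ.nbDstgFin (FinRun.ofSeq q ω n) ∧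
        FinRun.ofSeq q ω n ∈ Γ.neverSmallBelief b ε} ≤ ENNReal.ofReal ε := by
    calc (Γ.env e).runMeasure σ q {ω | ∃ n : ℕ, k * N ≤ Γ.nbDstgFin (FinRun.ofSeq q ω n) ∧
            FinRun.ofSeq q ω n ∈ Γ.neverSmallBelief b ε}
        ≤ (Γ.env e).runMeasure σ q (⋃ f, {ω | ∃ n, FinRun.ofSeq q ω n ∈
            {ρ | N ≤ Γ.nbDstgPair e f ρ ∧ ρ ∈ Γ.neverSmallBelief b ε}}) := by
          refine measure_mono fun ω ⟨n, hn, hb⟩ => ?_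
          obtain ⟨f, -, hf⟩ := Finset.exists_le_of_sum_le (s := Finset.univ)
            (f := fun _ : E => N) (g := fun f => Γ.nbDstgPair e f (FinRun.ofSeq q ω n))
            Finset.univ_nonempty
            (by simpa [hk] using hn.trans (Γ.nbDstgFin_le_sum e _))
          exact Set.mem_iUnion.2 ⟨f, n, hf, hb⟩
      _ ≤ ∑ f : E, (Γ.env e).runMeasure σ q {ω | ∃ n, FinRun.ofSeq q ω n ∈
            {ρ | N ≤ Γ.nbDstgPair e f ρ ∧ ρ ∈ Γ.neverSmallBelief b ε}} :=
          measure_iUnion_fintype_le _ _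
      _ ≤ ∑ _f : E, ENNReal.ofReal (ε / k) := Finset.sum_le_sum fun f _ =>
          (Γ.runMeasure_nbDstgPair_le b e f hγ1 ENNReal.ofReal_ne_top
            (Γ.tsum_sqrt_mul_inv_le_one hD hsep e f) hε q σ N).trans (inv_mul_pow_le hD hk0 hε)
      _ = ENNReal.ofReal ε := by
          rw [Finset.sum_const, Finset.card_univ, ← hk, ← ENNReal.ofReal_nsmul, nsmul_eq_mul,
            mul_div_cancel₀ _ (by exact_mod_cast hk0.ne')]
  -- The first event is contained in the second.
  refine ⟨le_trans (measure_mono ?_) hfin, hfin⟩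
  rintro ω ⟨hω, hb⟩
  obtain ⟨n, hn⟩ := Γ.exists_le_nbDstgFin q ω _ hω
  exact ⟨n, hn, hb n⟩
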